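/- Let $\mathcal T$ be a triangulated category in which direct sums indexed by arbitrary sets exist. An object $G$ of $\mathcal T$ is called compact if $\operatorname{Hom}_{\mathcal T}(G,-)$, as a functor to abelian groups, commutes with direct sums. Let $C$ be a compact object with $\operatorname{Hom}_{\mathcal T}(C,C[n])=0$ for all $n>0$, and assume that $\{C[i] : i\in\mathbb Z\}$ is a generating set, that is, a collection of compact objects, stable under shift, such that every $X\in\mathcal T$ with $\operatorname{Hom}_{\mathcal T}(C[i],X)=0$ for all $i\in\mathbb Z$ is zero. For $n\in\mathbb Z$ let $\mathcal T^{\le n}(C)$ (resp. $\mathcal T^{\ge n}(C)$) be the full subcategory of all $X\in\mathcal T$ with $\operatorname{Hom}_{\mathcal T}(C,X[i])=0$ for all $i>n$ (resp. all $i<n$), and put $\mathcal T^0(C)=\mathcal T^{\le 0}(C)\cap\mathcal T^{\ge 0}(C)$. Let $B=\operatorname{End}_{\mathcal T}(C)^{\mathrm{op}}$ and let $\operatorname{Mod}B$ be the category of left $B$-modules. Then: 1. $(\mathcal T^{\le 0}(C),\mathcal T^{\ge 0}(C))$ is a $t$-structure on $\mathcal T$, with $\mathcal T^{\le 0}(C)[-n]=\mathcal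 T^{\le n}(C)$ and $\mathcal T^{\ge 0}(C)[-n]=\mathcal T^{\ge n}(C)$ for all $n\in\mathbb Z$, and it is non-degenerate: $\bigcap_{n\in\mathbb Z}\mathcal T^{\le n}(C)=\bigcap_{n\in\mathbb Z}\mathcal T^{\ge n}(C)=\{0\}$. 2. $\mathcal T^0(C)$ is admissible abelian: $\operatorname{Hom}_{\mathcal T}(X,Y[n])=0$ for all $X,Y\in\mathcal T^0(C)$ and $n<0$, and for every morphism $f:X\to Y$ in $\mathcal T^0(C)$ and every distinguished triangle $X\xrightarrow{f}Y\to S\to X[1]$ there is a distinguished triangle $K[1]\to S\to Q\to K[2]$ with $K,Q\in\mathcal T^0(C)$. In particular $\mathcal T^0(C)$, with the addition of morphisms inherited from $\mathcal T$, is an abelian category. 3. The functor $\operatorname{Hom}_{\mathcal T}(C,-):\mathcal T^0(C)\to\operatorname{Mod}B$ is an equivalence of categories. -/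

import Mathlib

open CategoryTheory CategoryTheory.Limits CategoryTheory.Pretriangulated

universe v u

namespace CompactTStructure

section Compact

variable {T : Type u} [Category.{v} T] [Preadditive T]

/-- An object `C` is compact if the functor `Hom(C, -)` to abelian groups commutes with
all set-indexed direct sums. -/
def IsCompactObject (C : T) : Prop :=
  ∀ J : Type v, PreservesColimitsOfShape (Discrete J) (preadditiveCoyoneda.obj (Opposite.op C))

variable [HasShift T ℤ]

/-- A collection of compact objects, stable (up to isomorphism) under all shifts, such that
`X = 0` whenever `Hom(G, X) = 0` for every `G` in the collection. -/
structure IsGeneratingSet (S : ObjectProperty T) : Prop where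
  compact : ∀ G : T, S G → IsCompactObject G
  stable : ∀ G : T, S G → ∀ n : ℤ, S.isoClosure (G⟦n⟧)
  eq_zero : ∀ X : T, (∀ G : T, S G → ∀ f : G ⟶ X, f = 0) → IsZero X

/-- The collection `{C[i] : i ∈ ℤ}`. -/
def shifts (C : T) : ObjectProperty T :=
  ObjectProperty.ofObj (fun i : ℤ ↦ C⟦i⟧)

/-- The full subcategory `T^{≤ n}(C)` of the `X` with `Hom(C, X[i]) = 0` for `i > n`. -/
def homLE (C : T) (n : ℤ) : ObjectProperty T :=
  fun X ↦ ∀ i : ℤ, n < i → ∀ f : C ⟶ X⟦i⟧, f = 0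

/-- The full subcategory `T^{≥ n}(C)` of the `X` with `Hom(C, X[i]) = 0` for `i < n`. -/
def homGE (C : T) (n : ℤ) : ObjectProperty T :=
  fun X ↦ ∀ i : ℤ, i < n → ∀ f : C ⟶ X⟦i⟧, f = 0

/-- The full subcategory `T^0(C)`, the intersection of `T^{≤ 0}(C)` and `T^{≥ 0}(C)`. -/
def homHeart (C : T) : ObjectProperty T :=
  homLE C 0 ⊓ homGE C 0

end Compact

section Triangulated

variable {T : Type u} [Category.{v} T] [Preadditive T] [HasZeroObject T] [HasShift T ℤ]
  [∀ n : ℤ, (shiftFunctor T n).Additive] [Pretriangulated T]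

/-- A t-structure is non-degenerate if the intersection of all the `T^{≤ n}` and the
intersection of all the `T^{≥ n}` consist of the zero objects. -/
def IsNondegenerate (t : Triangulated.TStructure T) : Prop :=
  (∀ X : T, (∀ n : ℤ, t.le n X) ↔ IsZero X) ∧ (∀ X : T, (∀ n : ℤ, t.ge n X) ↔ IsZero X)

/-- A full subcategory `P` of `T` is admissible abelian if `Hom(X, Y[n]) = 0` for all `X`, `Y`
in `P` and `n < 0`, and if every morphism of `P` is `P`-admissible: its cone `S` lies in a
distinguished triangle `K[1] ⟶ S ⟶ Q ⟶` with `K` and `Q` in `P`. -/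
structure IsAdmissibleAbelian (P : ObjectProperty T) : Prop where
  hom_eq_zero : ∀ X Y : T, P X → P Y → ∀ n : ℤ, n < 0 → ∀ f : X ⟶ Y⟦n⟧, f = 0
  admissible : ∀ ⦃X Y : P.FullSubcategory⦄ (f : X ⟶ Y),
    Triangulated.AbelianSubcategory.admissibleMorphism P.ι f

end Triangulated

end CompactTStructure

/-! Truncation by killing cells: put `A 0 = X` and let `A (n + 1)` be the cone of the tautological
map to `A n` from a coproduct of copies of the `C[i]`, `i ≥ 0`. Compactness lets maps from `C[k]` to
the homotopy colimit `V` be studied stage by stage. If `k ≥ 0` they die at the next stage, so `V`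
lies in `T^{≥1}`. If `k < 0` there are no nonzero maps from `C[k]` to the cells, so the fibre `U` of
`X ⟶ V` lies in `T^{≤0}`. Maps to an object of `T^{≥1}` extend from each stage to the next, whence
also `Hom(U, T^{≥1}) = 0` (`exists_truncation_triangle`). For `X` in `T^{≤0}`, generation forces `V
= 0`, and orthogonality follows (`hom_eq_zero_of_homLE_of_homGE`).

The heart of any t-structure is admissible abelian. In the equivalence with modules, copowers of `C`
play the role of free modules: covering `X` by a copower with fibre in `T^{≤0}` gives full
faithfulness, and the truncated cone of a free presentation realises any module. -/

namespace CompactTStructure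

/-! ### Maps from a compact object to a coproduct -/

section Coproduct

variable {T : Type u} [Category.{v} T] [Preadditive T]

/-- Morphisms from a compact object to a coproduct are generated, under addition, by the
morphisms which factor through one of the summands. -/
theorem IsCompactObject.hom_sigma_induction {K : T} (hK : IsCompactObject K) {J : Type*}
    [Small.{v} J] (X : J → T) [HasCoproduct X] {P : (K ⟶ ∐ X) → Prop} (zero : P 0)
    (add : ∀ f g, P f → P g → P (f + g))
    (summand : ∀ (j : J) (g : K ⟶ X j), P (g ≫ Sigma.ι X j)) (f : K ⟶ ∐ X) : P f := by
  classical
  have := hK (Shrink.{v} J)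
  have : PreservesColimitsOfShape (Discrete J) (preadditiveCoyoneda.obj (Opposite.op K)) :=
    preservesColimitsOfShape_of_equiv (Discrete.equivalence (equivShrink.{v} J).symm) _
  let F := preadditiveCoyoneda.obj (Opposite.op K)
  have hc := isColimitOfPreserves F (coproductIsCoproduct X)
  let H : AddSubgroup (K ⟶ ∐ X) :=
    AddSubgroup.closure {f | ∃ (j : J) (g : K ⟶ X j), f = g ≫ Sigma.ι X j}
  -- The quotient by `H` kills every summand, hence vanishes on the colimit `Hom(K, ∐ X)`.
  have hq : AddCommGrpCat.ofHom (QuotientAddGroup.mk' H) =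
      (0 : F.obj (∐ X) ⟶ AddCommGrpCat.of ((K ⟶ ∐ X) ⧸ H)) := by
    refine hc.hom_ext ?_
    rintro ⟨j⟩
    ext (g : K ⟶ X j)
    exact (QuotientAddGroup.eq_zero_iff _).2 (AddSubgroup.subset_closure ⟨j, g, rfl⟩)
  have hf : f ∈ H := (QuotientAddGroup.eq_zero_iff _).1 (ConcreteCategory.congr_hom hq f)
  -- `P` is not assumed stable under negation, but the generators of `H` are, so both signs are
  -- carried along.
  have hneg : ∀ x ∈ H, P x ∧ P (-x) := by
    intro x hx
    induction hx using AddSubgroup.closure_induction with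
    | mem x hx =>
      obtain ⟨j, g, rfl⟩ := hx
      exact ⟨summand j g, by simpa using summand j (-g)⟩
    | zero => simpa using zero
    | add x y _ _ hx hy => exact ⟨add _ _ hx.1 hy.1, by
        rw [neg_add]; exact add _ _ hx.2 hy.2⟩
    | neg x _ hx => exact ⟨hx.2, by simpa using hx.1⟩
  exact (hneg f hf).1

theorem IsCompactObject.eq_zero_of_sigma {K : T} (hK : IsCompactObject K) {J : Type*}
    [Small.{v} J] (X : J → T) [HasCoproduct X] (h : ∀ (j : J) (g : K ⟶ X j), g = 0)
    (f : K ⟶ ∐ X) : f = 0 := by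
  refine hK.hom_sigma_induction X (P := fun f ↦ f = 0) rfl (fun f g hf hg ↦ ?_) (fun j g ↦ ?_) f
  · rw [hf, hg, add_zero]
  · rw [h j g, zero_comp]

theorem IsCompactObject.eq_zero_of_comp_sigma_π {K : T} (hK : IsCompactObject K) {J : Type*}
    [DecidableEq J] [Small.{v} J] (X : J → T) [HasCoproduct X] (f : K ⟶ ∐ X)
    (h : ∀ j, f ≫ Sigma.π X j = 0) : f = 0 := by
  have key : ∃ s : Finset J, f = ∑ j ∈ s, f ≫ Sigma.π X j ≫ Sigma.ι X j := by
    suffices ∃ s : Finset J, ∀ t, s ⊆ t → f = ∑ j ∈ t, f ≫ Sigma.π X j ≫ Sigma.ι X j by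
      obtain ⟨s, hs⟩ := this
      exact ⟨s, hs s subset_rfl⟩
    clear h
    refine hK.hom_sigma_induction X (P := fun f ↦ ∃ s : Finset J, ∀ t, s ⊆ t →
      f = ∑ j ∈ t, f ≫ Sigma.π X j ≫ Sigma.ι X j) ⟨∅, by simp⟩ (fun f g hf hg ↦ ?_)
      (fun j g ↦ ?_) f
    · obtain ⟨s, hs⟩ := hf
      obtain ⟨t, ht⟩ := hg
      refine ⟨s ∪ t, fun r hr ↦ ?_⟩
      simp only [Preadditive.add_comp, Finset.sum_add_distrib]
      rw [← hs r (Finset.union_subset_left hr), ← ht r (Finset.union_subset_right hr)]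
    · refine ⟨{j}, fun t ht ↦ ?_⟩
      rw [Finset.sum_eq_single j]
      · simp
      · intro i _ hi
        simp [Sigma.ι_π_of_ne_assoc X hi.symm]
      · intro hj
        exact absurd (ht (Finset.mem_singleton_self j)) hj
  obtain ⟨s, hs⟩ := key
  rw [hs]
  exact Finset.sum_eq_zero fun j _ ↦ by rw [← Category.assoc, h j, zero_comp]

theorem IsCompactObject.exists_comp_sigma_π_eq_zero {K : T} (hK : IsCompactObject K)
    (X : ℕ → T) [HasCoproduct X] (f : K ⟶ ∐ X) :
    ∃ n, f ≫ Sigma.π X n = 0 := by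
  suffices ∃ N, ∀ n, N ≤ n → f ≫ Sigma.π X n = 0 from
    this.imp fun N h ↦ h N le_rfl
  refine hK.hom_sigma_induction X (P := fun f ↦ ∃ N, ∀ n, N ≤ n → f ≫ Sigma.π X n = 0)
    ⟨0, by simp⟩ (fun f g hf hg ↦ ?_) (fun j g ↦ ?_) f
  · obtain ⟨N, hN⟩ := hf
    obtain ⟨M, hM⟩ := hg
    refine ⟨max N M, fun n hn ↦ ?_⟩
    rw [Preadditive.add_comp, hN n (le_of_max_le_left hn), hM n (le_of_max_le_right hn), add_zero]
  · refine ⟨j + 1, fun n hn ↦ ?_⟩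
    rw [Category.assoc, Sigma.ι_π_of_ne X (by lia), comp_zero]

end Coproduct

/-! ### Shifting the vanishing conditions -/

section Shift

variable {T : Type u} [Category.{v} T] [Preadditive T] [HasShift T ℤ]
  [∀ n : ℤ, (shiftFunctor T n).Additive]

theorem forall_hom_shift_eq_zero_iff (K X : T) {i j k : ℤ} (h : k + i = j) :
    (∀ f : K⟦j⟧ ⟶ X⟦i⟧, f = 0) ↔ ∀ f : K⟦k⟧ ⟶ X, f = 0 := by
  let e : (K⟦k⟧)⟦i⟧ ≅ K⟦j⟧ := (shiftFunctorAdd' T k i j h).symm.app K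
  constructor
  · intro H f
    apply (shiftFunctor T i).map_injective
    rw [Functor.map_zero, ← cancel_epi e.inv, H (_ ≫ _), comp_zero]
  · intro H f
    rw [← cancel_epi e.hom, comp_zero]
    obtain ⟨g, hg⟩ := (shiftFunctor T i).map_surjective (e.hom ≫ f)
    rw [← hg, H g, Functor.map_zero]

theorem forall_hom_to_shift_eq_zero_iff (K X : T) {i k : ℤ} (h : k + i = 0) :
    (∀ f : K ⟶ X⟦i⟧, f = 0) ↔ ∀ f : K⟦k⟧ ⟶ X, f = 0 := by
  rw [← forall_hom_shift_eq_zero_iff K X h]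
  let e : K⟦(0 : ℤ)⟧ ≅ K := (shiftFunctorZero T ℤ).app K
  exact ⟨fun H f ↦ by rw [← cancel_epi e.inv, H (_ ≫ _), comp_zero],
    fun H f ↦ by rw [← cancel_epi e.hom, H (_ ≫ _), comp_zero]⟩

theorem homLE_iff (C : T) (n : ℤ) (X : T) :
    homLE C n X ↔ ∀ k : ℤ, k < -n → ∀ f : C⟦k⟧ ⟶ X, f = 0 := by
  constructor
  · intro H k hk
    exact (forall_hom_to_shift_eq_zero_iff C X (add_neg_cancel k)).1 (H (-k) (by lia))
  · intro H i hi
    exact (forall_hom_to_shift_eq_zero_iff C X (neg_add_cancel i)).2 (H (-i) (by lia))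

theorem homGE_iff (C : T) (n : ℤ) (X : T) :
    homGE C n X ↔ ∀ k : ℤ, -n < k → ∀ f : C⟦k⟧ ⟶ X, f = 0 := by
  constructor
  · intro H k hk
    exact (forall_hom_to_shift_eq_zero_iff C X (add_neg_cancel k)).1 (H (-k) (by lia))
  · intro H i hi
    exact (forall_hom_to_shift_eq_zero_iff C X (neg_add_cancel i)).2 (H (-i) (by lia))

end Shift

/-! ### The map `1 - shift` of a sequence -/

section Sequential

variable {T : Type u} [Category.{v} T] [Preadditive T] (A : ℕ → T) (a : ∀ n, A n ⟶ A (n + 1))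
  [HasCoproduct A]

/-- The endomorphism `1 - shift` of the coproduct of a sequence, whose cone is the
homotopy colimit of the sequence. -/
noncomputable def idSubShift : ∐ A ⟶ ∐ A :=
  Sigma.desc fun n ↦ Sigma.ι A n - a n ≫ Sigma.ι A (n + 1)

theorem ι_idSubShift (n : ℕ) :
    Sigma.ι A n ≫ idSubShift A a = Sigma.ι A n - a n ≫ Sigma.ι A (n + 1) := by
  simp [idSubShift]

theorem idSubShift_π_zero : idSubShift A a ≫ Sigma.π A 0 = Sigma.π A 0 := by
  refine Sigma.hom_ext _ _ fun n ↦ ?_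
  rw [← Category.assoc, ι_idSubShift, Preadditive.sub_comp, Category.assoc,
    Sigma.ι_π_of_ne A (Nat.succ_ne_zero n), comp_zero, sub_zero]

theorem idSubShift_π_succ (n : ℕ) :
    idSubShift A a ≫ Sigma.π A (n + 1) = Sigma.π A (n + 1) - Sigma.π A n ≫ a n := by
  refine Sigma.hom_ext _ _ fun m ↦ ?_
  rw [← Category.assoc, ι_idSubShift, Preadditive.sub_comp, Preadditive.comp_sub, Category.assoc]
  congr 1
  by_cases h : m = n
  · subst h
    simp
  · rw [Sigma.ι_π_of_ne A (by lia), Sigma.ι_π_of_ne_assoc A h, comp_zero, zero_comp]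

/-- The components satisfy `f₀ = 0` and `fₙ₊₁ = fₙ ≫ aₙ`, so all vanish; compactness makes
components detect `f`. -/
theorem IsCompactObject.eq_zero_of_comp_idSubShift {K : T} (hK : IsCompactObject K)
    (f : K ⟶ ∐ A) (hf : f ≫ idSubShift A a = 0) : f = 0 := by
  refine hK.eq_zero_of_comp_sigma_π A f fun n ↦ ?_
  induction n with
  | zero => rw [← idSubShift_π_zero A a, reassoc_of% hf, zero_comp]
  | succ n ih =>
    have := congr($hf ≫ Sigma.π A (n + 1))
    rwa [Category.assoc, idSubShift_π_succ, Preadditive.comp_sub, ← Category.assoc, ih,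
      zero_comp, zero_comp, sub_zero] at this

end Sequential

/-! ### Long exact sequences of a distinguished triangle -/

section Exactness

variable {T : Type u} [Category.{v} T] [Preadditive T] [HasZeroObject T] [HasShift T ℤ]
  [∀ n : ℤ, (shiftFunctor T n).Additive] [Pretriangulated T]
  {X Y Z : T} {f : X ⟶ Y} {g : Y ⟶ Z} {h : Z ⟶ X⟦(1 : ℤ)⟧}

theorem exists_eq_comp_mor₁ (hT : Triangle.mk f g h ∈ distTriang T) {W : T} (y : W ⟶ Y)
    (hy : y ≫ g = 0) : ∃ x : W ⟶ X, y = x ≫ f :=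
  Triangle.coyoneda_exact₂ _ hT y hy

theorem exists_eq_comp_mor₂ (hT : Triangle.mk f g h ∈ distTriang T) {W : T} (z : W ⟶ Z)
    (hz : z ≫ h = 0) : ∃ y : W ⟶ Y, z = y ≫ g :=
  Triangle.coyoneda_exact₃ _ hT z hz

theorem exists_eq_mor₂_comp (hT : Triangle.mk f g h ∈ distTriang T) {W : T} (y : Y ⟶ W)
    (hy : f ≫ y = 0) : ∃ z : Z ⟶ W, y = g ≫ z :=
  Triangle.yoneda_exact₂ _ hT y hy

theorem exists_eq_mor₃_comp (hT : Triangle.mk f g h ∈ distTriang T) {W : T} (z : Z ⟶ W)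
    (hz : g ≫ z = 0) : ∃ x : X⟦(1 : ℤ)⟧ ⟶ W, z = h ≫ x :=
  Triangle.yoneda_exact₃ _ hT z hz

theorem exists_shift_eq_mor₁_comp (hT : Triangle.mk f g h ∈ distTriang T) {W : T}
    (x : X ⟶ W) (hx : h ≫ x⟦(1 : ℤ)⟧' = 0) : ∃ y : Y ⟶ W, x = f ≫ y := by
  obtain ⟨y, hy⟩ := Triangle.yoneda_exact₂ _ (rot_of_distTriang _ (rot_of_distTriang _ hT))
    (x⟦(1 : ℤ)⟧') hx
  obtain ⟨y, rfl⟩ : ∃ y' : Y ⟶ W, y'⟦(1 : ℤ)⟧' = y := (shiftFunctor T (1 : ℤ)).map_surjective y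
  -- Rotating twice turns `f` into `-f[1]`, hence the sign.
  refine ⟨-y, (shiftFunctor T (1 : ℤ)).map_injective ?_⟩
  rw [Functor.map_comp, Functor.map_neg, Preadditive.comp_neg, ← Preadditive.neg_comp]
  exact hy

theorem exists_comp_shift_eq (hT : Triangle.mk f g h ∈ distTriang T) {W : T}
    (w : W ⟶ X⟦(1 : ℤ)⟧) (hw : w ≫ f⟦(1 : ℤ)⟧' = 0) : ∃ z : W ⟶ Z, w = z ≫ h :=
  Triangle.coyoneda_exact₁ _ hT w hw

theorem hom_right_eq_zero (hT : Triangle.mk f g h ∈ distTriang T) {W : T}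
    (h₂ : ∀ y : W ⟶ Y, y = 0) (h₁ : ∀ x : W ⟶ X⟦(1 : ℤ)⟧, x = 0) (z : W ⟶ Z) : z = 0 := by
  obtain ⟨y, rfl⟩ := exists_eq_comp_mor₂ hT z (h₁ _)
  rw [h₂ y, zero_comp]


theorem hom_left_eq_zero (hT : Triangle.mk f g h ∈ distTriang T) {K : T} {k : ℤ}
    (h₂ : ∀ x : K⟦k⟧ ⟶ X, x ≫ f = 0)
    (h₃ : ∀ z : K⟦k + 1⟧ ⟶ Z, ∃ y : K⟦k + 1⟧ ⟶ Y, z = y ≫ g) (x : K⟦k⟧ ⟶ X) : x = 0 := by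
  have hgh : g ≫ h = 0 := comp_distTriang_mor_zero₂₃ _ hT
  let e : K⟦k⟧⟦(1 : ℤ)⟧ ≅ K⟦k + 1⟧ := (shiftFunctorAdd T k 1).symm.app K
  obtain ⟨z, hz⟩ := exists_comp_shift_eq hT (x⟦(1 : ℤ)⟧')
    (by rw [← Functor.map_comp, h₂, Functor.map_zero])
  obtain ⟨y, hy⟩ := h₃ (e.inv ≫ z)
  apply (shiftFunctor T (1 : ℤ)).map_injective
  rw [Functor.map_zero, hz, ← cancel_epi e.inv, comp_zero, ← Category.assoc, hy,
    Category.assoc, hgh, comp_zero]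

end Exactness

/-! ### Maps into and out of a homotopy colimit -/

section HomotopyColimit

variable {T : Type u} [Category.{v} T] [Preadditive T] [HasZeroObject T] [HasShift T ℤ]
  [∀ n : ℤ, (shiftFunctor T n).Additive] [Pretriangulated T]
  {A : ℕ → T} {a : ∀ n, A n ⟶ A (n + 1)} [HasCoproduct A] {V : T} {q : ∐ A ⟶ V}
  {δ : V ⟶ (∐ A)⟦(1 : ℤ)⟧} (hV : Triangle.mk (idSubShift A a) q δ ∈ distTriang T)

include hV

theorem ι_comp_hocolim (n : ℕ) : a n ≫ Sigma.ι A (n + 1) ≫ q = Sigma.ι A n ≫ q := by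
  have h : idSubShift A a ≫ q = 0 := comp_distTriang_mor_zero₁₂ _ hV
  have := congr(Sigma.ι A n ≫ $h)
  rw [← Category.assoc, ι_idSubShift, Preadditive.sub_comp, comp_zero, sub_eq_zero] at this
  rw [this, Category.assoc]

/-- Since `δ` lands in `(∐ A)[1]`, showing `f ≫ δ = 0` uses injectivity of `1 - shift` on maps from
`K[-1]`; then `f` lifts to `∐ A`, where compactness applies. -/
theorem exists_hom_to_hocolim_factor {K : T} (hK : IsCompactObject K)
    (hK' : IsCompactObject (K⟦(-1 : ℤ)⟧)) (f : K ⟶ V) :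
    ∃ (n : ℕ) (g : K ⟶ A n), f = g ≫ Sigma.ι A n ≫ q := by
  have hδ : f ≫ δ = 0 := by
    let e : ∐ A ≅ (∐ A)⟦(1 : ℤ)⟧⟦(-1 : ℤ)⟧ := (shiftEquiv T (1 : ℤ)).unitIso.app (∐ A)
    apply (shiftFunctor T (-1 : ℤ)).map_injective
    rw [Functor.map_zero, ← cancel_mono e.inv, zero_comp]
    refine hK'.eq_zero_of_comp_idSubShift A a _ ?_
    have hD : δ ≫ (idSubShift A a)⟦(1 : ℤ)⟧' = 0 := comp_distTriang_mor_zero₃₁ _ hV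
    have hn : e.inv ≫ idSubShift A a = (idSubShift A a)⟦(1 : ℤ)⟧'⟦(-1 : ℤ)⟧' ≫ e.inv :=
      ((shiftEquiv T (1 : ℤ)).unitIso.inv.naturality (idSubShift A a)).symm
    rw [Category.assoc, hn, ← Category.assoc, ← Functor.map_comp, Category.assoc, hD, comp_zero,
      Functor.map_zero, zero_comp]
  obtain ⟨f, rfl⟩ := exists_eq_comp_mor₂ hV f hδ
  -- Asking for all large `n` lets two summands be moved to a common stage.
  suffices ∃ N, ∀ n, N ≤ n → ∃ g : K ⟶ A n, f ≫ q = g ≫ Sigma.ι A n ≫ q from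
    let ⟨N, h⟩ := this; ⟨N, h N le_rfl⟩
  refine hK.hom_sigma_induction A
    (P := fun f ↦ ∃ N, ∀ n, N ≤ n → ∃ g : K ⟶ A n, f ≫ q = g ≫ Sigma.ι A n ≫ q)
    ⟨0, fun n _ ↦ ⟨0, by simp⟩⟩ (fun f g hf hg ↦ ?_) (fun j g ↦ ⟨j, fun n hn ↦ ?_⟩) f
  · obtain ⟨N, hN⟩ := hf
    obtain ⟨M, hM⟩ := hg
    refine ⟨max N M, fun n hn ↦ ?_⟩
    obtain ⟨f', hf'⟩ := hN n (le_of_max_le_left hn)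
    obtain ⟨g', hg'⟩ := hM n (le_of_max_le_right hn)
    exact ⟨f' + g', by rw [Preadditive.add_comp, Preadditive.add_comp, hf', hg']⟩
  · induction n, hn using Nat.le_induction with
    | base => exact ⟨g, Category.assoc _ _ _⟩
    | succ n _ ih =>
      obtain ⟨g', hg'⟩ := ih
      exact ⟨g' ≫ a n, by rw [hg', Category.assoc, ι_comp_hocolim hV]⟩

theorem hom_to_hocolim_eq_zero {K : T} (hK : IsCompactObject K)
    (hK' : IsCompactObject (K⟦(-1 : ℤ)⟧)) (h : ∀ n (g : K ⟶ A n), g ≫ a n = 0) (f : K ⟶ V) :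
    f = 0 := by
  obtain ⟨n, g, rfl⟩ := exists_hom_to_hocolim_factor hV hK hK' f
  rw [← ι_comp_hocolim hV, reassoc_of% (h n g), zero_comp]

theorem hom_to_hocolim_surjective {K : T} (hK : IsCompactObject K)
    (hK' : IsCompactObject (K⟦(-1 : ℤ)⟧))
    (h : ∀ n (g : K ⟶ A (n + 1)), ∃ g' : K ⟶ A n, g = g' ≫ a n) (f : K ⟶ V) :
    ∃ g : K ⟶ A 0, f = g ≫ Sigma.ι A 0 ≫ q := by
  obtain ⟨n, g, rfl⟩ := exists_hom_to_hocolim_factor hV hK hK' f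
  induction n with
  | zero => exact ⟨g, rfl⟩
  | succ n ih =>
    obtain ⟨g', rfl⟩ := h n g
    obtain ⟨g'', h'⟩ := ih g'
    exact ⟨g'', by rw [← h', Category.assoc, ι_comp_hocolim hV]⟩

/-- If `g` dies in the colimit, it starts a sequence `tₙ₊₁ = tₙ ≫ aₙ` of components of one map `t`.
Compactness makes some `t_N` zero, and injectivity descends to `t₀ = g`. -/
theorem hom_to_hocolim_injective {K : T} (hK : IsCompactObject K)
    (h : ∀ n (g : K ⟶ A n), g ≫ a n = 0 → g = 0) (g : K ⟶ A 0)
    (hg : g ≫ Sigma.ι A 0 ≫ q = 0) : g = 0 := by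
  obtain ⟨t, ht⟩ := exists_eq_comp_mor₁ hV (g ≫ Sigma.ι A 0) (by rw [Category.assoc, hg])
  have h₀ : g = t ≫ Sigma.π A 0 := by
    rw [← idSubShift_π_zero A a, ← Category.assoc, ← ht]
    simp
  have hs (n : ℕ) : t ≫ Sigma.π A (n + 1) = (t ≫ Sigma.π A n) ≫ a n := by
    have := congr($ht ≫ Sigma.π A (n + 1))
    rw [Category.assoc, Category.assoc, idSubShift_π_succ, Sigma.ι_π_of_ne A (by lia), comp_zero,
      Preadditive.comp_sub, eq_comm, sub_eq_zero] at this
    rw [this, Category.assoc]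
  obtain ⟨N, hN⟩ := hK.exists_comp_sigma_π_eq_zero A t
  rw [h₀]
  induction N with
  | zero => exact hN
  | succ N ih => exact ih (h N _ (by rw [← hs, hN]))

theorem hom_from_hocolim_surjective {Y : T}
    (h : ∀ n (g : A n ⟶ Y), ∃ g' : A (n + 1) ⟶ Y, g = a n ≫ g') (g : A 0 ⟶ Y) :
    ∃ f : V ⟶ Y, g = Sigma.ι A 0 ≫ q ≫ f := by
  choose ext hext using h
  let G (n : ℕ) : A n ⟶ Y := Nat.rec g ext n
  obtain ⟨f, hf⟩ := exists_eq_mor₂_comp hV (Sigma.desc G) (by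
    refine Sigma.hom_ext _ _ fun n ↦ ?_
    rw [← Category.assoc, ι_idSubShift, Preadditive.sub_comp, Category.assoc, Sigma.ι_desc,
      Sigma.ι_desc, comp_zero, sub_eq_zero]
    exact hext n (G n))
  exact ⟨f, by rw [← hf, Sigma.ι_desc]; rfl⟩

/-- A `lim¹` vanishing: extendability along each `a n` allows `k = (1 - shift) ≫ G` to be solved
recursively, and `δ` kills the shift of `1 - shift`. -/
theorem hom_from_hocolim_injective {Y : T}
    (h : ∀ n (g : A n ⟶ Y), ∃ g' : A (n + 1) ⟶ Y, g = a n ≫ g')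
    (h' : ∀ n (g : A (n + 1) ⟶ Y⟦(1 : ℤ)⟧), a n ≫ g = 0 → g = 0) (f : V ⟶ Y⟦(1 : ℤ)⟧)
    (hf : Sigma.ι A 0 ≫ q ≫ f = 0) : f = 0 := by
  have hq : q ≫ f = 0 := by
    refine Sigma.hom_ext _ _ fun n ↦ ?_
    rw [comp_zero]
    induction n with
    | zero => exact hf
    | succ n ih =>
      apply h'
      rw [← Category.assoc, ← Category.assoc, Category.assoc (a n), ι_comp_hocolim hV,
        Category.assoc, ih]
  obtain ⟨k, rfl⟩ := exists_eq_mor₃_comp hV f hq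
  obtain ⟨k, rfl⟩ := (shiftFunctor T (1 : ℤ)).map_surjective k
  choose ext hext using h
  let G (n : ℕ) : A n ⟶ Y := Nat.rec 0 (fun n g ↦ ext n (g - Sigma.ι A n ≫ k)) n
  have hG : k = idSubShift A a ≫ Sigma.desc G := by
    refine Sigma.hom_ext _ _ fun n ↦ ?_
    rw [← Category.assoc, ι_idSubShift, Preadditive.sub_comp, Category.assoc, Sigma.ι_desc,
      Sigma.ι_desc, eq_sub_iff_add_eq, ← eq_sub_iff_add_eq']
    exact (hext n (G n - Sigma.ι A n ≫ k)).symm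
  have hD : δ ≫ (idSubShift A a)⟦(1 : ℤ)⟧' = 0 := comp_distTriang_mor_zero₃₁ _ hV
  rw [hG, Functor.map_comp, reassoc_of% hD, zero_comp]

end HomotopyColimit

/-! ### Compactness and vanishing for the shifts of `C` -/

section Compact

variable {T : Type u} [Category.{v} T] [Preadditive T]

theorem IsCompactObject.of_iso {K L : T} (hK : IsCompactObject K) (e : K ≅ L) :
    IsCompactObject L := fun J ↦
  have := hK J
  preservesColimitsOfShape_of_natIso (preadditiveCoyoneda.mapIso e.symm.op)

variable [HasShift T ℤ]

theorem IsGeneratingSet.isCompactObject_shift {C : T} (h : IsGeneratingSet (shifts C)) (k : ℤ) :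
    IsCompactObject (C⟦k⟧) :=
  h.compact _ (ObjectProperty.ofObj_apply _ k)

theorem IsGeneratingSet.isCompactObject_shift_shift {C : T} (h : IsGeneratingSet (shifts C))
    (k l : ℤ) : IsCompactObject (C⟦k⟧⟦l⟧) :=
  (h.isCompactObject_shift (k + l)).of_iso ((shiftFunctorAdd T k l).app C)

theorem IsGeneratingSet.isZero {C : T} (h : IsGeneratingSet (shifts C)) {X : T}
    (hX : ∀ (k : ℤ) (f : C⟦k⟧ ⟶ X), f = 0) : IsZero X :=
  h.eq_zero X (by rintro _ ⟨k⟩ f; exact hX k f)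

variable [∀ n : ℤ, (shiftFunctor T n).Additive]

theorem hom_shift_eq_zero {C : T} (hpos : ∀ n : ℤ, 0 < n → ∀ f : C ⟶ C⟦n⟧, f = 0) {k l : ℤ} (hkl : k < l)
    (f : C⟦k⟧ ⟶ C⟦l⟧) : f = 0 :=
  (forall_hom_shift_eq_zero_iff C (C⟦l⟧) (add_zero k) |>.1 fun f ↦ by
    let e : C⟦l - k⟧⟦k⟧ ≅ C⟦l⟧⟦(0 : ℤ)⟧ :=
      (shiftFunctorAdd' T (l - k) k l (by lia)).symm.app C ≪≫ (shiftFunctorZero T ℤ).symm.app _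
    rw [← cancel_mono e.inv, zero_comp]
    obtain ⟨g, hg⟩ := (shiftFunctor T k).map_surjective (f ≫ e.inv)
    rw [← hg, hpos (l - k) (by lia) g, Functor.map_zero]) f

end Compact

/-! ### Attaching cells and the truncation triangle -/

section Cells

variable {T : Type u} [Category.{v} T] [HasShift T ℤ] [HasCoproducts.{v} T]
  (C : T)

/-- The coproduct of copies of `C[i]` for `i ≥ 0`, indexed by all morphisms to `A`. -/
noncomputable def cells (A : T) : T :=
  ∐ fun j : Σ i : ℕ, (C⟦(i : ℤ)⟧ ⟶ A) ↦ C⟦(j.1 : ℤ)⟧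

/-- The tautological morphism from the coproduct of cells. -/
noncomputable def cellsMap (A : T) : cells C A ⟶ A :=
  Sigma.desc fun j ↦ j.2

variable {C}

theorem exists_eq_comp_cellsMap {A : T} {k : ℤ} (hk : 0 ≤ k) (f : C⟦k⟧ ⟶ A) :
    ∃ g : C⟦k⟧ ⟶ cells C A, f = g ≫ cellsMap C A := by
  obtain ⟨i, rfl⟩ := Int.eq_ofNat_of_zero_le hk
  exact ⟨Sigma.ι (fun j : Σ i : ℕ, (C⟦(i : ℤ)⟧ ⟶ A) ↦ C⟦(j.1 : ℤ)⟧) ⟨i, f⟩,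
    (Sigma.ι_desc (fun j : Σ i : ℕ, (C⟦(i : ℤ)⟧ ⟶ A) ↦ j.2) ⟨i, f⟩).symm⟩

variable [Preadditive T]

theorem cells_hom_eq_zero {A Y : T} (hY : ∀ (k : ℤ), 0 ≤ k → ∀ f : C⟦k⟧ ⟶ Y, f = 0)
    (f : cells C A ⟶ Y) : f = 0 :=
  Sigma.hom_ext _ _ fun j ↦ (hY j.1 (by lia) _).trans comp_zero.symm

variable [∀ n : ℤ, (shiftFunctor T n).Additive]

theorem hom_cells_eq_zero (hpos : ∀ n : ℤ, 0 < n → ∀ f : C ⟶ C⟦n⟧, f = 0)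
    (hgen : IsGeneratingSet (shifts C)) {A : T} {k : ℤ} (hk : k < 0) (f : C⟦k⟧ ⟶ cells C A) :
    f = 0 :=
  (hgen.isCompactObject_shift k).eq_zero_of_sigma _
    (fun j ↦ hom_shift_eq_zero hpos (by lia)) f

end Cells

section Truncation

variable {T : Type u} [Category.{v} T] [Preadditive T] [HasZeroObject T] [HasShift T ℤ]
  [∀ n : ℤ, (shiftFunctor T n).Additive] [Pretriangulated T] [HasCoproducts.{v} T]

variable (C : T)

/-- The cone of the morphism from the coproduct of cells. -/
noncomputable def killCells (A : T) : T :=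
  (distinguished_cocone_triangle (cellsMap C A)).choose

/-- The morphism to the cone of `cellsMap`. -/
noncomputable def toKillCells (A : T) : A ⟶ killCells C A :=
  (distinguished_cocone_triangle (cellsMap C A)).choose_spec.choose

theorem exists_killCells_triangle (A : T) : ∃ δ : killCells C A ⟶ (cells C A)⟦(1 : ℤ)⟧,
    Triangle.mk (cellsMap C A) (toKillCells C A) δ ∈ distTriang T :=
  (distinguished_cocone_triangle (cellsMap C A)).choose_spec.choose_spec

variable {C}

theorem comp_toKillCells {A : T} {k : ℤ} (hk : 0 ≤ k) (f : C⟦k⟧ ⟶ A) :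
    f ≫ toKillCells C A = 0 := by
  obtain ⟨δ, hT⟩ := exists_killCells_triangle C A
  obtain ⟨g, rfl⟩ := exists_eq_comp_cellsMap hk f
  have : cellsMap C A ≫ toKillCells C A = 0 := comp_distTriang_mor_zero₁₂ _ hT
  rw [Category.assoc, this, comp_zero]

theorem exists_eq_comp_toKillCells (hpos : ∀ n : ℤ, 0 < n → ∀ f : C ⟶ C⟦n⟧, f = 0)
    (hgen : IsGeneratingSet (shifts C)) {A : T} {k : ℤ} (hk : k ≤ 0)
    (f : C⟦k⟧ ⟶ killCells C A) : ∃ g : C⟦k⟧ ⟶ A, f = g ≫ toKillCells C A := by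
  obtain ⟨δ, hT⟩ := exists_killCells_triangle C A
  refine exists_eq_comp_mor₂ hT f ?_
  -- The obstruction lies in `Hom(C[k-1], cells)`, so surjectivity reaches `k = 0`, one degree
  -- beyond injectivity.
  exact (forall_hom_shift_eq_zero_iff C (cells C A) (sub_add_cancel k 1)).2
    (hom_cells_eq_zero hpos hgen (by lia)) _

theorem eq_zero_of_comp_toKillCells (hpos : ∀ n : ℤ, 0 < n → ∀ f : C ⟶ C⟦n⟧, f = 0)
    (hgen : IsGeneratingSet (shifts C)) {A : T} {k : ℤ} (hk : k < 0)
    (f : C⟦k⟧ ⟶ A) (hf : f ≫ toKillCells C A = 0) : f = 0 := by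
  obtain ⟨δ, hT⟩ := exists_killCells_triangle C A
  obtain ⟨g, rfl⟩ := exists_eq_comp_mor₁ hT f hf
  rw [hom_cells_eq_zero hpos hgen hk g, zero_comp]

theorem exists_eq_toKillCells_comp {A Y : T}
    (hY : ∀ (k : ℤ), 0 ≤ k → ∀ f : C⟦k⟧ ⟶ Y, f = 0) (f : A ⟶ Y) :
    ∃ g, f = toKillCells C A ≫ g := by
  obtain ⟨δ, hT⟩ := exists_killCells_triangle C A
  exact exists_eq_mor₂_comp hT f (cells_hom_eq_zero hY _)

theorem eq_zero_of_toKillCells_comp {A Y : T}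
    (hY : ∀ (k : ℤ), 0 ≤ k → ∀ f : C⟦k⟧ ⟶ Y, f = 0) (f : killCells C A ⟶ Y⟦(1 : ℤ)⟧)
    (hf : toKillCells C A ≫ f = 0) : f = 0 := by
  obtain ⟨δ, hT⟩ := exists_killCells_triangle C A
  obtain ⟨g, rfl⟩ := exists_eq_mor₃_comp hT f hf
  obtain ⟨g, rfl⟩ := (shiftFunctor T (1 : ℤ)).map_surjective g
  rw [cells_hom_eq_zero hY g, Functor.map_zero, comp_zero]

variable (C) in
theorem exists_truncation_triangle (hpos : ∀ n : ℤ, 0 < n → ∀ f : C ⟶ C⟦n⟧, f = 0)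
    (hgen : IsGeneratingSet (shifts C)) (X : T) :
    ∃ (U V : T) (u : U ⟶ X) (p : X ⟶ V) (w : V ⟶ U⟦(1 : ℤ)⟧),
      Triangle.mk u p w ∈ distTriang T ∧ homLE C 0 U ∧ homGE C 1 V ∧
        ∀ Y, homGE C 1 Y → ∀ f : U ⟶ Y, f = 0 := by
  have := hasCoproducts_shrink.{0, v} (C := T)
  let A (n : ℕ) : T := Nat.rec X (fun _ A ↦ killCells C A) n
  let a (n : ℕ) : A n ⟶ A (n + 1) := toKillCells C (A n)
  obtain ⟨V, q, δ, hV⟩ := distinguished_cocone_triangle (idSubShift A a)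
  let p : X ⟶ V := Sigma.ι A 0 ≫ q
  obtain ⟨U, u, w, hT⟩ := distinguished_cocone_triangle₁ p
  refine ⟨U, V, u, p, w, hT, ?_, ?_, ?_⟩
  · rw [homLE_iff]
    intro k hk
    have hup : u ≫ p = 0 := comp_distTriang_mor_zero₁₂ _ hT
    -- For `k < 0`, the fibre needs injectivity at `k` and surjectivity at `k + 1 ≤ 0`, exactly the
    -- available ranges.
    exact hom_left_eq_zero hT
      (fun f ↦ hom_to_hocolim_injective hV (hgen.isCompactObject_shift k)
        (fun n g ↦ eq_zero_of_comp_toKillCells hpos hgen (by lia) g) _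
        (show (f ≫ u) ≫ p = 0 by rw [Category.assoc, hup, comp_zero]))
      (hom_to_hocolim_surjective hV (hgen.isCompactObject_shift (k + 1))
        (hgen.isCompactObject_shift_shift _ _)
        (fun n g ↦ exists_eq_comp_toKillCells hpos hgen (by lia) g))
  · rw [homGE_iff]
    intro k hk
    exact hom_to_hocolim_eq_zero hV (hgen.isCompactObject_shift k)
      (hgen.isCompactObject_shift_shift _ _) fun n g ↦ comp_toKillCells (by lia) g
  · intro Y hY f
    replace hY (k : ℤ) (hk : 0 ≤ k) : ∀ f : C⟦k⟧ ⟶ Y, f = 0 :=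
      (homGE_iff C 1 Y).1 hY k (by lia)
    have hpw : p ≫ w = 0 := comp_distTriang_mor_zero₂₃ _ hT
    have hup : u ≫ p = 0 := comp_distTriang_mor_zero₁₂ _ hT
    -- The map `w ≫ f[1]` restricts to zero on `X`, hence is zero, so `f` extends to `X`; extending
    -- further to `V` shows `f` factors through `u ≫ p = 0`.
    obtain ⟨g, rfl⟩ := exists_shift_eq_mor₁_comp hT f
      (hom_from_hocolim_injective hV (fun n ↦ exists_eq_toKillCells_comp hY)
        (fun n ↦ eq_zero_of_toKillCells_comp hY) _
        (show Sigma.ι A 0 ≫ q ≫ w ≫ f⟦(1 : ℤ)⟧' = (0 : X ⟶ Y⟦(1 : ℤ)⟧) by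
          have := congr($hpw ≫ f⟦(1 : ℤ)⟧')
          rw [zero_comp] at this
          rw [← this]
          simp only [p, Category.assoc]))
    obtain ⟨h, hh⟩ := hom_from_hocolim_surjective hV (fun n ↦ exists_eq_toKillCells_comp hY) g
    rw [hh]
    change u ≫ Sigma.ι A 0 ≫ q ≫ h = 0
    have := congr($hup ≫ h)
    rw [zero_comp] at this
    rw [← this]
    simp only [p, Category.assoc]

end Truncation

/-! ### The heart of a t-structure is admissible abelian -/

section Heart

variable {T : Type u} [Category.{v} T] [Preadditive T] [HasZeroObject T] [HasShift T ℤ]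
  [∀ n : ℤ, (shiftFunctor T n).Additive] [Pretriangulated T]

theorem isAdmissibleAbelian_heart (t : Triangulated.TStructure T) :
    IsAdmissibleAbelian t.heart where
  hom_eq_zero X Y hX hY n hn f := by
    rw [t.mem_heart_iff] at hX hY
    have := hX.1
    have := hY.2
    have : t.IsGE (Y⟦n⟧) (-n) := t.isGE_shift Y 0 n (-n)
    exact t.zero f 0 (-n)
  admissible X Y f S g h hT := by
    obtain ⟨X, hX⟩ := X
    obtain ⟨Y, hY⟩ := Y
    rw [t.mem_heart_iff] at hX hY
    obtain ⟨_, _⟩ := hX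
    obtain ⟨_, _⟩ := hY
    have : t.IsLE (X⟦(1 : ℤ)⟧) (-1) := t.isLE_shift X 0 1 (-1)
    have : t.IsGE (X⟦(1 : ℤ)⟧) (-1) := t.isGE_shift X 0 1 (-1)
    have hS : t.IsLE S 0 := t.isLE₂ _ (rot_of_distTriang _ hT) 0 ‹t.IsLE Y 0›
      (t.isLE_of_le (X⟦(1 : ℤ)⟧) (-1) 0)
    have hS' : t.IsGE S (-1) := t.isGE₂ _ (rot_of_distTriang _ hT) (-1)
      (t.isGE_of_ge Y (-1) 0) ‹t.IsGE (X⟦(1 : ℤ)⟧) (-1)›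
    -- The cone `S` sits in degrees `-1` and `0`; its truncations are the shifted kernel and the
    -- cokernel.
    obtain ⟨K, Q, hK, hQ, a, b, c, hT'⟩ := t.exists_triangle S (-1) 0 (by lia)
    rw [t.le_iff_isLE] at hK
    rw [t.ge_iff_isGE] at hQ
    have : t.IsGE (Q⟦(-1 : ℤ)⟧) 1 := t.isGE_shift Q 0 (-1) 1
    have : t.IsLE (K⟦(1 : ℤ)⟧) (-2) := t.isLE_shift K (-1) 1 (-2)
    have hK' : t.IsGE K (-1) := t.isGE₂ _ (inv_rot_of_distTriang _ hT') (-1)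
      (t.isGE_of_ge (Q⟦(-1 : ℤ)⟧) (-1) 1) hS'
    have hQ' : t.IsLE Q 0 := t.isLE₂ _ (rot_of_distTriang _ hT') 0 hS
      (t.isLE_of_le (K⟦(1 : ℤ)⟧) (-2) 0)
    let e : K⟦(-1 : ℤ)⟧⟦(1 : ℤ)⟧ ≅ K := (shiftEquiv T (1 : ℤ)).counitIso.app K
    refine ⟨⟨K⟦(-1 : ℤ)⟧, (t.mem_heart_iff _).2 ⟨t.isLE_shift K (-1) (-1) 0,
      t.isGE_shift K (-1) (-1) 0⟩⟩, ⟨Q, (t.mem_heart_iff _).2 ⟨hQ', hQ⟩⟩, e.hom ≫ a, b,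
      c ≫ e.inv⟦(1 : ℤ)⟧', isomorphic_distinguished _ hT' _ ?_⟩
    refine Triangle.isoMk _ _ e (Iso.refl _) (Iso.refl _) ?_ ?_ ?_
    · exact Category.comp_id _
    · exact (Category.comp_id _).trans (Category.id_comp _).symm
    · change (c ≫ e.inv⟦(1 : ℤ)⟧') ≫ e.hom⟦(1 : ℤ)⟧' = 𝟙 _ ≫ c
      rw [Category.assoc, ← Functor.map_comp, e.inv_hom_id, CategoryTheory.Functor.map_id, Category.comp_id,
        Category.id_comp]

theorem IsAdmissibleAbelian.exists_abelian [IsTriangulated T] {P : ObjectProperty T} (hP : IsAdmissibleAbelian P)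
    [P.IsClosedUnderFiniteProducts] :
    ∃ a : Abelian P.FullSubcategory, a.toPreadditive = Preadditive.fullSubcategory P :=
  ⟨Triangulated.AbelianSubcategory.abelian P.ι
    (fun X Y n f hn ↦ hP.hom_eq_zero _ _ X.property Y.property n hn f)
    (by ext X Y f; simpa using hP.admissible f), rfl⟩

end Heart

/-! ### Closure properties of the aisles -/

section Limits

variable {T : Type u} [Category.{v} T] [Preadditive T] [HasShift T ℤ]
  [∀ n : ℤ, (shiftFunctor T n).Additive]

variable (C : T)

instance (n : ℤ) (J : Type*) [Category* J] : (homLE C n).IsClosedUnderLimitsOfShape J where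
  limitsOfShape_le X := by
    rintro ⟨h⟩
    rw [homLE_iff]
    exact fun k hk f ↦ h.isLimit.hom_ext fun j ↦
      ((homLE_iff C n _).1 (h.prop_diag_obj j) k hk _).trans zero_comp.symm

instance (n : ℤ) (J : Type*) [Category* J] : (homGE C n).IsClosedUnderLimitsOfShape J where
  limitsOfShape_le X := by
    rintro ⟨h⟩
    rw [homGE_iff]
    exact fun k hk f ↦ h.isLimit.hom_ext fun j ↦
      ((homGE_iff C n _).1 (h.prop_diag_obj j) k hk _).trans zero_comp.symm

instance (J : Type*) [Category* J] : (homHeart C).IsClosedUnderLimitsOfShape J where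
  limitsOfShape_le X := by
    rintro ⟨h⟩
    exact ⟨ObjectProperty.LimitOfShape.prop (P := homLE C 0)
        { h with prop_diag_obj := fun j ↦ (h.prop_diag_obj j).1 },
      ObjectProperty.LimitOfShape.prop (P := homGE C 0)
        { h with prop_diag_obj := fun j ↦ (h.prop_diag_obj j).2 }⟩

instance : (homHeart C).IsClosedUnderFiniteProducts where

instance (n : ℤ) : (homLE C n).IsClosedUnderIsomorphisms where
  of_iso {X Y} e hX := by
    rw [homLE_iff] at hX ⊢
    exact fun k hk f ↦ by rw [← cancel_mono e.inv, hX k hk (_ ≫ _), zero_comp]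

instance (n : ℤ) : (homGE C n).IsClosedUnderIsomorphisms where
  of_iso {X Y} e hX := by
    rw [homGE_iff] at hX ⊢
    exact fun k hk f ↦ by rw [← cancel_mono e.inv, hX k hk (_ ≫ _), zero_comp]

variable {C}

theorem homLE_shift {n a n' : ℤ} (h : a + n' = n) {X : T} (hX : homLE C n X) :
    homLE C n' (X⟦a⟧) := by
  rw [homLE_iff] at hX ⊢
  exact fun k hk ↦ (forall_hom_shift_eq_zero_iff C X (sub_add_cancel k a)).2 (hX _ (by lia))

theorem homGE_shift {n a n' : ℤ} (h : a + n' = n) {X : T} (hX : homGE C n X) :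
    homGE C n' (X⟦a⟧) := by
  rw [homGE_iff] at hX ⊢
  exact fun k hk ↦ (forall_hom_shift_eq_zero_iff C X (sub_add_cancel k a)).2 (hX _ (by lia))

end Limits

/-! ### The t-structure and its non-degeneracy -/

section TStructure

variable {T : Type u} [Category.{v} T] [Preadditive T] [HasZeroObject T] [HasShift T ℤ]
  [∀ n : ℤ, (shiftFunctor T n).Additive] [Pretriangulated T] [HasCoproducts.{v} T] {C : T}

theorem hom_eq_zero_of_homLE_of_homGE (hpos : ∀ n : ℤ, 0 < n → ∀ f : C ⟶ C⟦n⟧, f = 0)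
    (hgen : IsGeneratingSet (shifts C)) {X Y : T} (hX : homLE C 0 X) (hY : homGE C 1 Y)
    (f : X ⟶ Y) : f = 0 := by
  obtain ⟨U, V, u, p, w, hT, hU, hV, hUV⟩ := exists_truncation_triangle C hpos hgen X
  -- `V` is in `T^{≥1}`, and in `T^{≤0}` as an extension of `U[1]` by `X`, so no shift of `C` maps
  -- to it nontrivially.
  have hV₀ : IsZero V := hgen.isZero fun k ↦ by
    rw [homLE_iff] at hX hU
    rw [homGE_iff] at hV
    by_cases hk : k < 0
    · exact hom_right_eq_zero hT (hX k (by lia))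
        ((forall_hom_shift_eq_zero_iff C U (sub_add_cancel k 1)).2 (hU _ (by lia)))
    · exact hV k (by lia)
  obtain ⟨g, rfl⟩ := exists_eq_mor₂_comp hT f (hUV Y hY _)
  rw [hV₀.eq_of_src g 0, comp_zero]

/-- The t-structure defined by a compact generator without positive self-extensions. -/
@[simps le ge]
def tStructure (hpos : ∀ n : ℤ, 0 < n → ∀ f : C ⟶ C⟦n⟧, f = 0)
    (hgen : IsGeneratingSet (shifts C)) : Triangulated.TStructure T where
  le := homLE C
  ge := homGE C
  le_shift _ _ _ h _ hX := homLE_shift h hX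
  ge_shift _ _ _ h _ hX := homGE_shift h hX
  zero' _ _ f hX hY := hom_eq_zero_of_homLE_of_homGE hpos hgen hX hY f
  le_zero_le _ hX i hi := hX i (by lia)
  ge_one_le _ hX i hi := hX i (by lia)
  exists_triangle_zero_one X := by
    obtain ⟨U, V, u, p, w, hT, hU, hV, -⟩ := exists_truncation_triangle C hpos hgen X
    exact ⟨U, V, hU, hV, u, p, w, hT⟩

theorem isNondegenerate_tStructure (hpos : ∀ n : ℤ, 0 < n → ∀ f : C ⟶ C⟦n⟧, f = 0)
    (hgen : IsGeneratingSet (shifts C)) : IsNondegenerate (tStructure hpos hgen) := by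
  constructor
  · intro X
    simp only [tStructure_le, homLE_iff]
    exact ⟨fun h ↦ hgen.isZero fun k ↦ h (-k - 1) k (by lia), fun h _ _ _ f ↦ h.eq_of_tgt f 0⟩
  · intro X
    simp only [tStructure_ge, homGE_iff]
    exact ⟨fun h ↦ hgen.isZero fun k ↦ h (-k + 1) k (by lia), fun h _ _ _ f ↦ h.eq_of_tgt f 0⟩

end TStructure

/-! ### Copowers of `C` as free modules -/

section Copower

variable {T : Type u} [Category.{v} T] [Preadditive T] {C : T}

theorem linearCombination_comp {J : Type*} {X Y : T} (x : J → (C ⟶ X)) (b : J →₀ (End C)ᵐᵒᵖ)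
    (h : X ⟶ Y) :
    Finsupp.linearCombination (End C)ᵐᵒᵖ x b ≫ h =
      Finsupp.linearCombination (End C)ᵐᵒᵖ (fun j ↦ x j ≫ h) b :=
  Finsupp.apply_linearCombination (End C)ᵐᵒᵖ ((preadditiveCoyonedaObj C).map h).hom x b

theorem linearCombination_ι_injective {J : Type*} [HasCoproduct fun _ : J ↦ C] :
    Function.Injective (Finsupp.linearCombination (End C)ᵐᵒᵖ (Sigma.ι fun _ : J ↦ C)) := by
  classical
  rw [injective_iff_map_eq_zero]
  intro b hb
  ext j : 1
  have h := congr($hb ≫ Sigma.π (fun _ : J ↦ C) j)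
  rw [linearCombination_comp, zero_comp, Finsupp.linearCombination_apply,
    Finsupp.sum_eq_single j (fun i _ hi ↦ by rw [Sigma.ι_π_of_ne _ hi, smul_zero])
      (fun _ ↦ zero_smul _ _), Sigma.ι_π_eq_id] at h
  apply MulOpposite.unop_injective
  exact (Category.comp_id _).symm.trans h

theorem IsCompactObject.linearCombination_ι_surjective (hC : IsCompactObject C) {J : Type*}
    [Small.{v} J] [HasCoproduct fun _ : J ↦ C] :
    Function.Surjective (Finsupp.linearCombination (End C)ᵐᵒᵖ (Sigma.ι fun _ : J ↦ C)) := by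
  refine hC.hom_sigma_induction _ ⟨0, map_zero _⟩ ?_ ?_
  · rintro _ _ ⟨b, rfl⟩ ⟨c, rfl⟩
    exact ⟨b + c, map_add _ _ _⟩
  · exact fun j g ↦ ⟨Finsupp.single j (MulOpposite.op g),
      Finsupp.linearCombination_single _ _ _⟩

theorem IsGeneratingSet.homLE_sigma [HasShift T ℤ] [∀ n : ℤ, (shiftFunctor T n).Additive]
    (hgen : IsGeneratingSet (shifts C)) {n : ℤ} {J : Type*} [Small.{v} J] (X : J → T)
    [HasCoproduct X] (hX : ∀ j, homLE C n (X j)) : homLE C n (∐ X) := by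
  rw [homLE_iff]
  exact fun k hk ↦ (hgen.isCompactObject_shift k).eq_zero_of_sigma X
    fun j ↦ (homLE_iff C n _).1 (hX j) k hk

end Copower

section ShiftZero

variable {T : Type u} [Category.{v} T] [HasShift T ℤ] {C : T}

theorem exists_shift_zero_factor {X Y : T} {g : Y ⟶ X}
    (h : ∀ z : C ⟶ X, ∃ y : C ⟶ Y, z = y ≫ g) (z : C⟦(0 : ℤ)⟧ ⟶ X) :
    ∃ y : C⟦(0 : ℤ)⟧ ⟶ Y, z = y ≫ g := by
  let e : C⟦(0 : ℤ)⟧ ≅ C := (shiftFunctorZero T ℤ).app C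
  obtain ⟨y, hy⟩ := h (e.inv ≫ z)
  exact ⟨e.hom ≫ y, by rw [Category.assoc, ← hy, e.hom_inv_id_assoc]⟩

theorem eq_zero_of_homLE_neg [Preadditive T] {n : ℤ} (hn : n < 0) {X : T} (hX : homLE C n X) (f : C ⟶ X) :
    f = 0 := by
  let e : X⟦(0 : ℤ)⟧ ≅ X := (shiftFunctorZero T ℤ).app X
  rw [← cancel_mono e.inv, zero_comp]
  exact hX 0 hn _

end ShiftZero

/-! ### The equivalence of the heart with modules -/

section Equivalence

variable {T : Type u} [Category.{v} T] [Preadditive T] [HasZeroObject T] [HasShift T ℤ]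
  [∀ n : ℤ, (shiftFunctor T n).Additive] [Pretriangulated T] {C : T}

theorem homLE_fiber {K S X : T} {k : K ⟶ S} {p : S ⟶ X} {w : X ⟶ K⟦(1 : ℤ)⟧}
    (hT : Triangle.mk k p w ∈ distTriang T) (hS : homLE C 0 S) (hX : homLE C 0 X)
    (hp : ∀ z : C ⟶ X, ∃ y : C ⟶ S, z = y ≫ p) : homLE C 0 K := by
  rw [homLE_iff] at hS hX ⊢
  intro i hi
  refine hom_left_eq_zero hT (fun x ↦ hS i hi _) ?_
  rcases lt_or_eq_of_le (show i + 1 ≤ 0 by lia) with h | h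
  · exact fun z ↦ ⟨0, by rw [zero_comp]; exact hX _ (by lia) z⟩
  · rw [h]
    exact exists_shift_zero_factor hp

variable [HasCoproducts.{v} T] (hpos : ∀ n : ℤ, 0 < n → ∀ f : C ⟶ C⟦n⟧, f = 0)
  (hgen : IsGeneratingSet (shifts C))

include hpos hgen

theorem exists_cover_triangle {X : T} (hX : homLE C 0 X) :
    ∃ (K : T) (k : K ⟶ ∐ fun _ : C ⟶ X ↦ C) (w : X ⟶ K⟦(1 : ℤ)⟧),
      Triangle.mk k (Sigma.desc id) w ∈ distTriang T ∧ homLE C 0 K := by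
  obtain ⟨K, k, w, hT⟩ :=
    distinguished_cocone_triangle₁ (Sigma.desc (id : (C ⟶ X) → (C ⟶ X)))
  exact ⟨K, k, w, hT, homLE_fiber hT (hgen.homLE_sigma _ fun _ ↦ hpos) hX
    fun z ↦ ⟨Sigma.ι (fun _ : C ⟶ X ↦ C) z, (Sigma.ι_desc (id : (C ⟶ X) → (C ⟶ X)) z).symm⟩⟩

theorem shift_hom_eq_zero {K Y : T} (hK : homLE C 0 K) (hY : homGE C 0 Y)
    (f : K⟦(1 : ℤ)⟧ ⟶ Y) : f = 0 := by
  let t := tStructure hpos hgen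
  have : t.IsLE (K⟦(1 : ℤ)⟧) (-1) := ⟨t.le_shift 0 1 (-1) (by lia) K hK⟩
  have : t.IsGE Y 0 := ⟨hY⟩
  exact t.zero f (-1) 0

/-- Such an `f` vanishes on the covering copower, so it factors through `K[1]`, which lies in
`T^{≤-1}`. -/
theorem eq_zero_of_forall_comp_eq_zero {X Y : T} (hX : homLE C 0 X) (hY : homGE C 0 Y)
    (f : X ⟶ Y) (hf : ∀ x : C ⟶ X, x ≫ f = 0) : f = 0 := by
  obtain ⟨K, k, w, hT, hK⟩ := exists_cover_triangle hpos hgen hX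
  obtain ⟨h, rfl⟩ := exists_eq_mor₃_comp hT f
    (Sigma.hom_ext _ _ fun x ↦ by rw [Sigma.ι_desc_assoc, comp_zero]; exact hf x)
  rw [shift_hom_eq_zero hpos hgen hK hY h, comp_zero]

theorem exists_hom_of_linearMap (hC : IsCompactObject C) {X Y : T} (hX : homLE C 0 X)
    (hY : homGE C 0 Y) (φ : (C ⟶ X) →ₗ[(End C)ᵐᵒᵖ] (C ⟶ Y)) :
    ∃ h : X ⟶ Y, ∀ x : C ⟶ X, x ≫ h = φ x := by
  obtain ⟨K, k, w, hT, hK⟩ := exists_cover_triangle hpos hgen hX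
  let g : (∐ fun _ : C ⟶ X ↦ C) ⟶ Y := Sigma.desc φ
  have hg (c : C ⟶ ∐ fun _ : C ⟶ X ↦ C) : c ≫ g = φ (c ≫ Sigma.desc id) := by
    obtain ⟨b, rfl⟩ := hC.linearCombination_ι_surjective c
    rw [linearCombination_comp, linearCombination_comp, Finsupp.apply_linearCombination]
    congr 2
    ext x
    simp [g]
  have hkp : k ≫ Sigma.desc id = 0 := comp_distTriang_mor_zero₁₂ _ hT
  -- `K` need not lie in the heart; the vanishing criterion for `k ≫ g` only needs it in `T^{≤0}`.
  obtain ⟨h, hh⟩ := exists_eq_mor₂_comp hT g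
    (eq_zero_of_forall_comp_eq_zero hpos hgen hK hY _ fun c ↦ by
      rw [← Category.assoc, hg, Category.assoc, hkp, comp_zero, map_zero])
  refine ⟨h, fun x ↦ ?_⟩
  have := congr(Sigma.ι (fun _ : C ⟶ X ↦ C) x ≫ $hh)
  rw [Sigma.ι_desc, Sigma.ι_desc_assoc] at this
  exact this.symm

/-- `X` is the cone of a map of copowers lifting a free presentation of `M`; as `Hom(C, C^{(J)}[1])
= 0`, `Hom(C, X)` is the cokernel. -/
theorem exists_homLE_presentation (hC : IsCompactObject C) (M : Type v) [AddCommGroup M]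
    [Module (End C)ᵐᵒᵖ M] :
    ∃ X : T, homLE C 0 X ∧ Nonempty (M ≃ₗ[(End C)ᵐᵒᵖ] (C ⟶ X)) := by
  let B := (End C)ᵐᵒᵖ
  let ε : (M →₀ B) →ₗ[B] M := Finsupp.linearCombination B id
  have hε : Function.Surjective ε := Finsupp.linearCombination_id_surjective B M
  let α : (M →₀ B) →ₗ[B] (C ⟶ ∐ fun _ : M ↦ C) :=
    Finsupp.linearCombination B (Sigma.ι fun _ : M ↦ C)
  let d : (∐ fun _ : LinearMap.ker ε ↦ C) ⟶ ∐ fun _ : M ↦ C := Sigma.desc fun j ↦ α j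
  obtain ⟨X, q, w, hT⟩ := distinguished_cocone_triangle d
  have hS (J : Type v) : homLE C 0 (∐ fun _ : J ↦ C) :=
    hgen.homLE_sigma _ fun _ ↦ hpos
  let β : (M →₀ B) →ₗ[B] (C ⟶ X) := ((preadditiveCoyonedaObj C).map q).hom ∘ₗ α
  have hβ : Function.Surjective β := fun z ↦ by
    obtain ⟨y, rfl⟩ := exists_eq_comp_mor₂ hT z (hS _ 1 one_pos _)
    obtain ⟨b, rfl⟩ := hC.linearCombination_ι_surjective y
    exact ⟨b, rfl⟩
  have hker : LinearMap.ker ε = LinearMap.ker β := by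
    ext b
    constructor
    · intro hb
      have hdq : d ≫ q = 0 := comp_distTriang_mor_zero₁₂ _ hT
      have hd : Sigma.ι (fun _ : LinearMap.ker ε ↦ C) ⟨b, hb⟩ ≫ d = α b := Sigma.ι_desc _ _
      change α b ≫ q = 0
      rw [← hd, Category.assoc, hdq, comp_zero]
    · intro hb
      obtain ⟨t, ht⟩ := exists_eq_comp_mor₁ hT (α b) hb
      obtain ⟨c, rfl⟩ := hC.linearCombination_ι_surjective t
      have hc : α b = α (Finsupp.linearCombination B Subtype.val c) := by
        rw [ht, linearCombination_comp, Finsupp.apply_linearCombination]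
        congr 2
        ext j
        exact Sigma.ι_desc _ _
      rw [linearCombination_ι_injective hc, Finsupp.linearCombination_apply]
      exact Submodule.sum_mem _ fun j _ ↦ Submodule.smul_mem _ _ j.2
  refine ⟨X, ?_, ⟨(ε.quotKerEquivOfSurjective hε).symm ≪≫ₗ Submodule.quotEquivOfEq _ _ hker ≪≫ₗ
    β.quotKerEquivOfSurjective hβ⟩⟩
  rw [homLE_iff]
  exact fun k hk ↦ hom_right_eq_zero hT ((homLE_iff C 0 _).1 (hS _) k hk)
    ((homLE_iff C 0 _).1 (fun i hi ↦ homLE_shift (n := 0) (n' := -1) (by lia) (hS _) i (by lia))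
      k hk)

/-- Removing the part `U` in `T^{≤-1}` leaves `Hom(C, -)` unchanged, since `C` has no nonzero maps
to `U` or `U[1]`. -/
theorem exists_homHeart_of_homLE {X : T} (hX : homLE C 0 X) :
    ∃ Y : T, homHeart C Y ∧ Nonempty ((C ⟶ X) ≃ₗ[(End C)ᵐᵒᵖ] (C ⟶ Y)) := by
  let t := tStructure hpos hgen
  obtain ⟨U, Y, hU, hY, u, p, w, hT⟩ := t.exists_triangle X (-1) 0 (by lia)
  replace hU : homLE C (-1) U := hU
  refine ⟨Y, ⟨?_, hY⟩, ⟨LinearEquiv.ofBijective ((preadditiveCoyonedaObj C).map p).hom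
    ⟨(injective_iff_map_eq_zero _).2 fun x hx ↦ ?_, fun z ↦ ?_⟩⟩⟩
  · rw [homLE_iff] at hX ⊢
    exact fun k hk ↦ hom_right_eq_zero hT (hX k hk) ((homLE_iff C 0 _).1
      (fun i hi ↦ homLE_shift (n' := -2) (by lia) hU i (by lia)) k hk)
  · obtain ⟨y, rfl⟩ := exists_eq_comp_mor₁ hT x hx
    rw [eq_zero_of_homLE_neg (by lia) hU y]
    exact zero_comp
  · obtain ⟨y, rfl⟩ := exists_eq_comp_mor₂ hT z (hU 1 (by lia) _)
    exact ⟨y, rfl⟩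

theorem isEquivalence_homHeart (hC : IsCompactObject C) :
    ((homHeart C).ι ⋙ preadditiveCoyonedaObj C).IsEquivalence where
  faithful := ⟨fun {X Y f g} h ↦ by
    ext
    rw [← sub_eq_zero]
    refine eq_zero_of_forall_comp_eq_zero hpos hgen X.property.1 Y.property.2 _ fun x ↦ ?_
    rw [Preadditive.comp_sub, sub_eq_zero]
    exact ConcreteCategory.congr_hom h x⟩
  full := ⟨fun {X Y} φ ↦ by
    obtain ⟨h, hh⟩ := exists_hom_of_linearMap hpos hgen hC X.property.1 Y.property.2 φ.hom
    exact ⟨(homHeart C).homMk h, by ext x; exact hh x⟩⟩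
  essSurj := ⟨fun M ↦ by
    obtain ⟨X, hX, ⟨e⟩⟩ := exists_homLE_presentation hpos hgen hC M
    obtain ⟨Y, hY, ⟨e'⟩⟩ := exists_homHeart_of_homLE hpos hgen hX
    exact ⟨⟨Y, hY⟩, ⟨(e ≪≫ₗ e').symm.toModuleIso⟩⟩⟩

end Equivalence

end CompactTStructure

theorem theorem1p3 {T : Type u} [Category.{v} T] [Preadditive T] [HasZeroObject T]
    [HasShift T ℤ] [∀ n : ℤ, (shiftFunctor T n).Additive] [Pretriangulated T]
    [IsTriangulated T] [HasCoproducts.{v} T] (C : T)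
    (hC : CompactTStructure.IsCompactObject C)
    (hpos : ∀ n : ℤ, 0 < n → ∀ f : C ⟶ C⟦n⟧, f = 0)
    (hgen : CompactTStructure.IsGeneratingSet (CompactTStructure.shifts C)) :
    (∃ t : Triangulated.TStructure T,
      (∀ n : ℤ, t.le n = CompactTStructure.homLE C n) ∧
      (∀ n : ℤ, t.ge n = CompactTStructure.homGE C n) ∧
      CompactTStructure.IsNondegenerate t) ∧
    (CompactTStructure.IsAdmissibleAbelian (CompactTStructure.homHeart C) ∧
      ∃ a : Abelian (CompactTStructure.homHeart C).FullSubcategory,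
        a.toPreadditive = Preadditive.fullSubcategory (CompactTStructure.homHeart C)) ∧
    ((CompactTStructure.homHeart C).ι ⋙ preadditiveCoyonedaObj C).IsEquivalence := by
  have hA : CompactTStructure.IsAdmissibleAbelian (CompactTStructure.homHeart C) :=
    CompactTStructure.isAdmissibleAbelian_heart (CompactTStructure.tStructure hpos hgen)
  exact ⟨⟨CompactTStructure.tStructure hpos hgen, fun _ ↦ rfl, fun _ ↦ rfl,
    CompactTStructure.isNondegenerate_tStructure hpos hgen⟩, ⟨hA, hA.exists_abelian⟩,
    CompactTStructure.isEquivalence_homHeart hpos hgen hC⟩
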